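/- Let $n=u+s$ with $u,s\ge 0$ and write points of $\mathbb{R}^n=\mathbb{R}^u\times\mathbb{R}^s$ as $z=(x,y)$. Let $(\cdot,\cdot)$ be the standard scalar product and $\|\cdot\|$ the Euclidean norm on $\mathbb{R}^u$ and on $\mathbb{R}^s$, equip $\mathbb{R}^n$ with the norm $\|(x,y)\|=\max(\|x\|,\|y\|)$, and equip linear maps of $\mathbb{R}^n$ with the corresponding operator norm. Let $A:\mathbb{R}^n\to\mathbb{R}^n$ be a linear map of the form $A(x,y)=(A_u x,A_s y)$, where $A_u:\mathbb{R}^u\to\mathbb{R}^u$ and $A_s:\mathbb{R}^s\to\mathbb{R}^s$ are linear maps for which there are constants $c_u>0$ and $c_s>0$ with $$(x,A_u x)\ge c_u\|x\|^2\quad\text{for all }x\in\mathbb{R}^u,\qquad (y,A_s y)\le -c_s\|y\|^2\quad\text{for all }y\in\mathbb{R}^s .$$ Then there exists $\epsilon_0=\epsilon_0(A)>0$, depending only on $A$, such that the following holds. Let $h:\mathbb{R}^n\to\mathbb{R}^n$ be of class $C^1$ (in particular, $h$ may be of class $C^k$ for any $k\ge 1$) and let $M,\epsilon\in\mathbb{R}$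 be such that $\|h(z)\|\le M$ and $\|Dh(z)\|\le\epsilon$ for all $z\in\mathbb{R}^n$. If $\epsilon<\epsilon_0$, then the equation $z'=Az+h(z)$ induces a dynamical system $\varphi:\mathbb{R}\times\mathbb{R}^n\to\mathbb{R}^n$ defined for all times, and there exists a homeomorphism $\rho:\mathbb{R}^n\to\mathbb{R}^n$ such that $$\rho\bigl(\exp(At)z\bigr)=\varphi\bigl(t,\rho(z)\bigr)\qquad\text{for all }t\in\mathbb{R},\ z\in\mathbb{R}^n .$$ (That $\varphi$ is the dynamical system induced by the equation means that $\varphi$ is a continuous flow, $t\mapsto\varphi(t,z)$ solves the equation on $\mathbb{R}$ for every $z$, and every solution $\gamma$ on an open interval containing $0$ satisfies $\gamma(t)=\varphi(t,\gamma(0))$ there.) -/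

import Mathlib

/-- The phase space `ℝⁿ = ℝᵘ × ℝˢ`, `n = u + s`. Each factor carries the Euclidean norm, and the
product carries the norm `‖(x, y)‖ = max ‖x‖ ‖y‖` (the norm of a product type in Mathlib);
continuous linear maps of the phase space carry the associated operator norm. -/
abbrev PhaseSpace (u s : ℕ) : Type :=
  EuclideanSpace ℝ (Fin u) × EuclideanSpace ℝ (Fin s)

/-- `φ` is the (global) dynamical system induced by the autonomous equation `z' = f z`:
every orbit of `φ` is a solution defined for all times, and every solution defined on an open
interval around time `0` is a piece of an orbit of `φ`, so that `φ` is determined by `f`. -/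
structure IsFlowOfODE {E : Type*} [NormedAddCommGroup E] [NormedSpace ℝ E]
    (f : E → E) (φ : Flow ℝ E) : Prop where
  hasDerivAt : ∀ (z : E) (t : ℝ), HasDerivAt (fun τ : ℝ => φ τ z) (f (φ t z)) t
  eq_of_solution : ∀ (a b : ℝ), a < 0 → 0 < b → ∀ γ : ℝ → E,
    (∀ t ∈ Set.Ioo a b, HasDerivAt γ (f (γ t)) t) →
      ∀ t ∈ Set.Ioo a b, γ t = φ t (γ 0)

/-! Put c = min(c_u, c_s). For bounded continuous forcing g, hyperbolicity yields a bounded solution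
of w' = A w + g, of size at most sup ‖g‖ / c: integrate over the future in the expanding block and
over the past in the contracting one. Let G g be its value at time 0 (`IsGreenOperator`).

Set σ z = z - G (τ ↦ h (φ τ z)). Subtracting from a perturbed orbit the bounded solution forced by h
along that orbit cancels h, so σ carries φ to the linear flow. Since G costs 1/c and h has Lipschitz
constant ε < c, their composite is a contraction. This makes σ injective, and surjective because
every linear orbit is shadowed by a perturbed one (`IsGreenOperator.exists_bounded_solution`). As σ
- id is bounded, σ is proper, hence a homeomorphism, and ρ = σ⁻¹. -/

section HartmanGrobman

open Set Filter Topology MeasureTheory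
open scoped NNReal Manifold ContDiff

/-! ### Global flows of Lipschitz vector fields. -/

section Flow

variable {E : Type*} [NormedAddCommGroup E] [NormedSpace ℝ E]

/-- Two global solutions of an autonomous Lipschitz equation diverge at most exponentially, in both
time directions. -/
theorem dist_le_mul_exp_abs_of_hasDerivAt {f : E → E} {K : ℝ≥0} (hf : LipschitzWith K f)
    {x y : ℝ → E} (hx : ∀ t, HasDerivAt x (f (x t)) t) (hy : ∀ t, HasDerivAt y (f (y t)) t)
    (t : ℝ) : dist (x t) (y t) ≤ dist (x 0) (y 0) * Real.exp (K * |t|) := by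
  have forward : ∀ (g : E → E), LipschitzWith K g → ∀ x y : ℝ → E,
      (∀ t, HasDerivAt x (g (x t)) t) → (∀ t, HasDerivAt y (g (y t)) t) →
      ∀ t, 0 ≤ t → dist (x t) (y t) ≤ dist (x 0) (y 0) * Real.exp (K * t) := by
    intro g hg x y hx hy t ht
    simpa using dist_le_of_trajectories_ODE (v := fun _ => g) (a := 0) (b := t) (fun _ => hg)
      (HasDerivAt.continuousOn fun s _ => hx s) (fun s _ => (hx s).hasDerivWithinAt)
      (HasDerivAt.continuousOn fun s _ => hy s) (fun s _ => (hy s).hasDerivWithinAt)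
      le_rfl t ⟨ht, le_rfl⟩
  rcases le_total 0 t with ht | ht
  · rw [abs_of_nonneg ht]
    exact forward f hf x y hx hy t ht
  · rw [abs_of_nonpos ht]
    have reverse : ∀ z : ℝ → E, (∀ t, HasDerivAt z (f (z t)) t) →
        ∀ t, HasDerivAt (fun s => z (-s)) (-f (z (-t))) t := by
      intro z hz t
      simpa [Function.comp_def] using (hz (-t)).scomp t (hasDerivAt_neg t)
    simpa using forward (fun z => -f z) hf.neg (fun s => x (-s)) (fun s => y (-s))
      (reverse x hx) (reverse y hy) (-t) (by linarith)

theorem eq_of_hasDerivAt_of_lipschitzWith {f : E → E} {K : ℝ≥0} (hf : LipschitzWith K f)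
    {x y : ℝ → E} (hx : ∀ t, HasDerivAt x (f (x t)) t) (hy : ∀ t, HasDerivAt y (f (y t)) t)
    (h0 : x 0 = y 0) (t : ℝ) : x t = y t := by
  have := dist_le_mul_exp_abs_of_hasDerivAt hf hx hy t
  rw [h0, dist_self, zero_mul] at this
  exact dist_le_zero.1 this

variable [CompleteSpace E]

/-- A globally Lipschitz `C¹` vector field has global solutions. -/
theorem exists_forall_hasDerivAt_of_lipschitzWith {f : E → E} {K : ℝ≥0} (hf : LipschitzWith K f)
    (hf1 : ContDiff ℝ 1 f) (z : E) : ∃ x : ℝ → E, x 0 = z ∧ ∀ t, HasDerivAt x (f (x t)) t := by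
  -- On the ball of radius ‖f z‖ + 1 about z the field is at most (‖f z‖ + 1)(1 + K), so the
  -- existence time 1 / (1 + K) is the same for all z. This uniformity lets local solutions be
  -- continued forever.
  set T : ℝ := 1 / (1 + K) with hTdef
  have hT : 0 < T := by positivity
  have hloc : ∀ z : E, ∃ x : ℝ → E, x 0 = z ∧
      IsMIntegralCurveOn (I := 𝓘(ℝ, E)) x (fun y => f y) (Ioo (-T) T) := by
    intro z
    have hP : IsPicardLindelof (fun _ : ℝ => f) (tmin := -T) (tmax := T)
        ⟨0, by constructor <;> linarith⟩ z (‖f z‖₊ + 1) 0 ((‖f z‖₊ + 1) * (1 + K)) K := by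
      refine IsPicardLindelof.of_time_independent (fun y hy => ?_) hf.lipschitzOnWith ?_
      · have h1 := hf.dist_le_mul y z
        rw [Metric.mem_closedBall] at hy
        push_cast at hy ⊢
        have h2 : ‖f y‖ ≤ ‖f z‖ + dist (f y) (f z) := by
          rw [dist_eq_norm]
          simpa using norm_add_le (f z) (f y - f z)
        have h3 := mul_le_mul_of_nonneg_left hy K.coe_nonneg
        nlinarith [norm_nonneg (f z)]
      · push_cast
        simp only [sub_zero, zero_sub, neg_neg, max_self, hTdef]
        have : (0 : ℝ) < 1 + K := by positivity
        apply le_of_eq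
        field_simp
    obtain ⟨x, hx0, hx⟩ := hP.exists_eq_forall_mem_Icc_hasDerivWithinAt₀
    refine ⟨x, hx0, fun t ht => ?_⟩
    exact hasMFDerivWithinAt_iff_hasFDerivWithinAt.2
      ((hx t (Ioo_subset_Icc_self ht)).mono Ioo_subset_Icc_self).hasFDerivWithinAt
  obtain ⟨x, hx0, hx⟩ := exists_isMIntegralCurve_of_isMIntegralCurveOn (I := 𝓘(ℝ, E))
    (v := fun y => f y) (contMDiff_vectorSpace_iff_contDiff.2 hf1) hT hloc z
  refine ⟨x, hx0, fun t => ?_⟩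
  have : HasFDerivAt x ((1 : ℝ →L[ℝ] ℝ).smulRight (f (x t))) t :=
    hasMFDerivAt_iff_hasFDerivAt.1 (hx t)
  exact this.hasDerivAt.congr_deriv (by simp)

/-- A globally Lipschitz `C¹` vector field induces a flow. -/
theorem exists_isFlowOfODE_of_lipschitzWith {f : E → E} {K : ℝ≥0} (hf : LipschitzWith K f)
    (hf1 : ContDiff ℝ 1 f) : ∃ φ : Flow ℝ E, IsFlowOfODE f φ := by
  choose x hx0 hx using exists_forall_hasDerivAt_of_lipschitzWith hf hf1
  refine ⟨⟨fun t z => x z t, ?_, fun t₁ t₂ z => ?_, hx0⟩, fun z t => hx z t, ?_⟩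
  · rw [continuous_iff_continuousAt]
    rintro ⟨t₀, z₀⟩
    have hx_cont : Continuous (x z₀) := continuous_iff_continuousAt.2 fun t => (hx z₀ t).continuousAt
    have hlim : Tendsto (fun p : ℝ × E => dist p.2 z₀ * Real.exp (K * |p.1|) +
        dist (x z₀ p.1) (x z₀ t₀)) (𝓝 (t₀, z₀)) (𝓝 0) := by
      have : Continuous fun p : ℝ × E => dist p.2 z₀ * Real.exp (K * |p.1|) +
        dist (x z₀ p.1) (x z₀ t₀) := by fun_prop
      simpa using this.tendsto (t₀, z₀)
    rw [ContinuousAt, tendsto_iff_dist_tendsto_zero]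
    refine squeeze_zero (fun _ => dist_nonneg) (fun p => ?_) hlim
    have := dist_le_mul_exp_abs_of_hasDerivAt hf (hx p.2) (hx z₀) p.1
    rw [hx0, hx0] at this
    exact (dist_triangle _ (x z₀ p.1) _).trans (by simpa [Function.uncurry] using this)
  · refine eq_of_hasDerivAt_of_lipschitzWith hf (x := fun s => x z (s + t₂)) (fun t => ?_)
      (hx (x z t₂)) ?_ t₁
    · exact (hx z (t + t₂)).comp_add_const t t₂
    · simp [hx0]
  · intro a b ha hb γ hγ t ht
    exact ODE_solution_unique_of_mem_Ioo (v := fun _ => f) (s := fun _ => univ) (K := K)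
      (fun _ _ => hf.lipschitzOnWith) (t₀ := 0) ⟨ha, hb⟩ (fun s hs => ⟨hγ s hs, trivial⟩)
      (fun s _ => ⟨hx (γ 0) s, trivial⟩) (hx0 _).symm ht

theorem hasDerivAt_exp_smul_apply (A : E →L[ℝ] E) (z : E) (t : ℝ) :
    HasDerivAt (fun s : ℝ => NormedSpace.exp (s • A) z) (A (NormedSpace.exp (t • A) z)) t := by
  simpa using (hasDerivAt_exp_smul_const' A t).clm_apply (hasDerivAt_const t z)

theorem eq_exp_smul_apply_of_hasDerivAt (A : E →L[ℝ] E) {x : ℝ → E}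
    (hx : ∀ t, HasDerivAt x (A (x t)) t) (t : ℝ) : x t = NormedSpace.exp (t • A) (x 0) :=
  eq_of_hasDerivAt_of_lipschitzWith A.lipschitz hx (hasDerivAt_exp_smul_apply A (x 0)) (by simp) t

end Flow

/-! ### Green operators and the conjugacy. -/

section Green

/-- A continuous map at bounded distance from the identity of a proper space is proper. -/
theorem isProperMap_of_norm_sub_le {E : Type*} [NormedAddCommGroup E] [ProperSpace E]
    {σ : E → E} (hσ : Continuous σ) {C : ℝ}
    (hC : ∀ z, ‖σ z - z‖ ≤ C) : IsProperMap σ := by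
  rw [isProperMap_iff_tendsto_cocompact]
  refine ⟨hσ, ?_⟩
  rw [← Metric.cobounded_eq_cocompact, ← tendsto_norm_atTop_iff_cobounded]
  refine tendsto_atTop_mono (f := fun z => ‖z‖ - C) (fun z => ?_)
    (tendsto_atTop_add_const_right _ _ tendsto_norm_cobounded_atTop)
  have := norm_sub_norm_le z (σ z)
  rw [norm_sub_rev] at this
  linarith [hC z]
variable {E : Type*} [NormedAddCommGroup E] [NormedSpace ℝ E]

/-- `G g` is the value at time `0` of a bounded solution of `w' = A w + g`, chosen linearly in the
bounded continuous forcing term `g`, with `‖G g‖ ≤ c⁻¹ sup ‖g‖`. -/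
structure IsGreenOperator (A : E →L[ℝ] E) (c : ℝ) (G : (ℝ → E) → E) : Prop where
  hasDerivAt : ∀ (g : ℝ → E) (S : ℝ), Continuous g → (∀ τ, ‖g τ‖ ≤ S) → ∀ t,
    HasDerivAt (fun s => G fun τ => g (s + τ)) (A (G fun τ => g (t + τ)) + g t) t
  norm_le : ∀ (g : ℝ → E) (S : ℝ), Continuous g → (∀ τ, ‖g τ‖ ≤ S) → ‖G g‖ ≤ S / c
  sub : ∀ (g₁ g₂ : ℝ → E) (S : ℝ), Continuous g₁ → Continuous g₂ → (∀ τ, ‖g₁ τ‖ ≤ S) →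
    (∀ τ, ‖g₂ τ‖ ≤ S) → G (fun τ => g₁ τ - g₂ τ) = G g₁ - G g₂
  tendsto : ∀ (g : ℕ → ℝ → E) (g' : ℝ → E) (S : ℝ), (∀ n, Continuous (g n)) →
    (∀ n τ, ‖g n τ‖ ≤ S) → (∀ τ, Tendsto (fun n => g n τ) atTop (𝓝 (g' τ))) →
    Tendsto (fun n => G (g n)) atTop (𝓝 (G g'))

variable {A : E →L[ℝ] E} {c : ℝ} {G : (ℝ → E) → E}

/-- If the forcing is Lipschitz with constant below `c`, the linear orbit through `p` is shadowed
by a solution of the perturbed equation. -/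
theorem IsGreenOperator.exists_bounded_solution [CompleteSpace E] (hG : IsGreenOperator A c G)
    (hc : 0 < c) {h : E → E} {M : ℝ} {K : ℝ≥0} (hM : ∀ z, ‖h z‖ ≤ M) (hK : LipschitzWith K h)
    (hKc : K < c) (p : E) : ∃ v : ℝ → E, Continuous v ∧
      ∀ t, v t = G fun τ => h (NormedSpace.exp ((t + τ) • A) p + v (t + τ)) := by
  have hlin : Continuous fun t : ℝ => NormedSpace.exp (t • A) p :=
    continuous_iff_continuousAt.2 fun t => (hasDerivAt_exp_smul_apply A p t).continuousAt
  let F : BoundedContinuousFunction ℝ E → ℝ → E :=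
    fun v τ => h (NormedSpace.exp (τ • A) p + v τ)
  have hF : ∀ v, Continuous (F v) := fun v => hK.continuous.comp (hlin.add v.continuous)
  have hFM : ∀ v τ, ‖F v τ‖ ≤ M := fun v τ => hM _
  let T : BoundedContinuousFunction ℝ E → BoundedContinuousFunction ℝ E := fun v =>
    BoundedContinuousFunction.ofNormedAddCommGroup (fun t => G fun τ => F v (t + τ))
      (continuous_iff_continuousAt.2 fun t =>
        (hG.hasDerivAt (F v) M (hF v) (hFM v) t).continuousAt) (M / c)
      (fun t => hG.norm_le _ M ((hF v).comp (by fun_prop)) fun τ => hFM v _)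
  -- The Lipschitz bound of h contributes K and the Green operator 1/c.
  have hT : ContractingWith (K / c.toNNReal) T := by
    refine ⟨?_, LipschitzWith.of_dist_le_mul fun v w => ?_⟩
    · rw [div_lt_one (by simpa using hc), Real.lt_toNNReal_iff_coe_lt]
      exact hKc
    · refine (BoundedContinuousFunction.dist_le (by positivity)).2 fun t => ?_
      change dist (G fun τ => F v (t + τ)) (G fun τ => F w (t + τ)) ≤ _
      have h1 : Continuous fun τ => F v (t + τ) := (hF v).comp (by fun_prop)
      have h2 : Continuous fun τ => F w (t + τ) := (hF w).comp (by fun_prop)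
      rw [dist_eq_norm, ← hG.sub _ _ M h1 h2 (fun _ => hFM v _) (fun _ => hFM w _)]
      refine (hG.norm_le _ (K * dist v w) (h1.sub h2) fun τ => ?_).trans_eq ?_
      · change ‖F v (t + τ) - F w (t + τ)‖ ≤ _
        rw [← dist_eq_norm]
        refine (hK.dist_le_mul _ _).trans ?_
        rw [dist_add_left]
        gcongr
        exact BoundedContinuousFunction.dist_coe_le_dist _
      · rw [NNReal.coe_div, Real.coe_toNNReal _ hc.le]
        ring
  let v : BoundedContinuousFunction ℝ E := hT.fixedPoint T
  refine ⟨v, v.continuous, fun t => ?_⟩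
  exact (DFunLike.congr_fun hT.fixedPoint_isFixedPt t).symm

/-- **Hartman–Grobman theorem** for a flow with bounded nonlinearity of small Lipschitz constant,
given a Green operator of the linear part. -/
theorem IsGreenOperator.exists_homeomorph_conj [ProperSpace E] (hG : IsGreenOperator A c G)
    (hc : 0 < c) {h : E → E} {M : ℝ} {K : ℝ≥0} (hM : ∀ z, ‖h z‖ ≤ M) (hK : LipschitzWith K h)
    (hKc : K < c) {φ : Flow ℝ E} (hφ : IsFlowOfODE (fun z => A z + h z) φ) :
    ∃ ρ : E ≃ₜ E, ∀ (t : ℝ) (z : E), ρ (NormedSpace.exp (t • A) z) = φ t (ρ z) := by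
  have hφc : Continuous (Function.uncurry fun (z : E) (t : ℝ) => φ t z) :=
    φ.continuous continuous_snd continuous_fst
  have hgc : Continuous (Function.uncurry fun (z : E) (t : ℝ) => h (φ t z)) :=
    hK.continuous.comp hφc
  have hgz : ∀ z, Continuous fun t => h (φ t z) := fun z =>
    hgc.comp (Continuous.prodMk_right z)
  have hGb : ∀ z, ‖G fun τ => h (φ τ z)‖ ≤ M / c := fun z =>
    hG.norm_le _ M (hgz z) fun _ => hM _
  -- The inverse of the desired conjugacy: unlike ρ, it is given by an explicit formula.
  let σ : E → E := fun z => z - G fun τ => h (φ τ z)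
  have hσc : Continuous σ := by
    refine continuous_id.sub (SeqContinuous.continuous fun z z' hz => ?_)
    exact hG.tendsto _ _ M (fun n => hgz (z n)) (fun _ _ => hM _) fun τ =>
      ((hgc.comp (Continuous.prodMk_left τ)).tendsto z').comp hz
  have hσ_orbit : ∀ t z, σ (φ t z) = φ t z - G fun τ => h (φ (t + τ) z) := by
    intro t z
    simp only [σ, ← φ.map_add, add_comm]
  have hσ_conj : ∀ t z, σ (φ t z) = NormedSpace.exp (t • A) (σ z) := by
    intro t z
    have := eq_exp_smul_apply_of_hasDerivAt A (x := fun t => σ (φ t z)) (fun t => ?_) t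
    · simpa using this
    · simp only [hσ_orbit]
      refine ((hφ.hasDerivAt z t).sub
        (hG.hasDerivAt (fun τ => h (φ τ z)) M (hgz z) (fun _ => hM _) t)).congr_deriv ?_
      rw [map_sub]
      abel
  have hinj : Function.Injective σ := by
    intro z w hzw
    -- Equal values of σ persist along orbits by the conjugacy, so the separation of the two orbits
    -- is a Green term. It is therefore bounded, and its supremum D satisfies D ≤ (K / c) D, forcing
    -- D = 0.
    have hdiff : ∀ t, φ t z - φ t w = G fun τ => h (φ τ (φ t z)) - h (φ τ (φ t w)) := by
      intro t
      rw [hG.sub _ _ M (hgz _) (hgz _) (fun _ => hM _) (fun _ => hM _)]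
      have h1 : σ (φ t z) = σ (φ t w) := by rw [hσ_conj, hσ_conj, hzw]
      exact sub_eq_sub_iff_sub_eq_sub.1 h1
    have hstep : ∀ D : ℝ, (∀ t, ‖φ t z - φ t w‖ ≤ D) → ∀ t, ‖φ t z - φ t w‖ ≤ K / c * D := by
      intro D hD t
      rw [hdiff]
      refine (hG.norm_le _ (K * D) ((hgz _).sub (hgz _)) fun τ => ?_).trans_eq (by ring)
      refine (hK.norm_sub_le _ _).trans ?_
      gcongr
      rw [← φ.map_add, ← φ.map_add]
      exact hD _
    have hbdd : BddAbove (range fun t => ‖φ t z - φ t w‖) := by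
      refine ⟨(2 * M) / c, ?_⟩
      rintro _ ⟨t, rfl⟩
      simp only
      rw [hdiff]
      refine hG.norm_le _ _ ((hgz _).sub (hgz _)) fun τ => ?_
      exact (norm_sub_le _ _).trans (by linarith [hM (φ τ (φ t z)), hM (φ τ (φ t w))])
    have hsup : (⨆ t, ‖φ t z - φ t w‖) ≤ K / c * ⨆ t, ‖φ t z - φ t w‖ :=
      ciSup_le (hstep _ fun t => le_ciSup hbdd t)
    have h0 := le_ciSup hbdd 0
    simp only [φ.map_zero_apply] at h0
    have hlt : (K : ℝ) / c < 1 := (div_lt_one hc).2 hKc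
    have : ‖z - w‖ ≤ 0 := by
      by_contra! hpos
      nlinarith
    exact sub_eq_zero.1 (norm_le_zero_iff.1 this)
  have hsurj : Function.Surjective σ := by
    intro p
    obtain ⟨v, hvc, hv⟩ := hG.exists_bounded_solution hc hM hK hKc p
    have hlin : Continuous fun t : ℝ => NormedSpace.exp (t • A) p :=
      continuous_iff_continuousAt.2 fun t => (hasDerivAt_exp_smul_apply A p t).continuousAt
    have hx : ∀ t, HasDerivAt (fun t => NormedSpace.exp (t • A) p + v t)
        (A (NormedSpace.exp (t • A) p + v t) + h (NormedSpace.exp (t • A) p + v t)) t := by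
      intro t
      have h1 := hG.hasDerivAt (fun τ => h (NormedSpace.exp (τ • A) p + v τ)) M
        (hK.continuous.comp (hlin.add hvc)) (fun _ => hM _) t
      simp only [← hv] at h1
      refine ((hasDerivAt_exp_smul_apply A p t).add h1).congr_deriv ?_
      rw [map_add]
      abel
    -- The shadowing curve is a genuine orbit, so its correction `v 0` is exactly the Green term
    -- that σ subtracts from `p + v 0`.
    have horbit : ∀ t, NormedSpace.exp (t • A) p + v t = φ t (p + v 0) := by
      intro t
      have := hφ.eq_of_solution (-(|t| + 1)) (|t| + 1) (by linarith [abs_nonneg t])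
        (by positivity) _ (fun t _ => hx t) t
        ⟨by linarith [neg_abs_le t], by linarith [le_abs_self t]⟩
      simpa using this
    refine ⟨p + v 0, ?_⟩
    have := hv 0
    simp only [zero_add, horbit] at this
    simp only [σ, ← this, add_sub_cancel_right]
  have hproper : IsProperMap σ := isProperMap_of_norm_sub_le hσc (C := M / c) fun z => by
    simpa [σ] using hGb z
  let e : E ≃ₜ E := IsHomeomorph.homeomorph σ
    (isHomeomorph_iff_continuous_isClosedMap_bijective.2 ⟨hσc, hproper.isClosedMap, hinj, hsurj⟩)
  refine ⟨e.symm, fun t z => ?_⟩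
  rw [Homeomorph.symm_apply_eq]
  change _ = σ (φ t (e.symm z))
  rw [hσ_conj]
  congr 1
  exact (e.apply_symm_apply z).symm

end Green

/-! ### The Green operator of an expanding linear map. -/

section Dichotomy

/-- If `B` is expanding at rate `c`, then `exp (-t B)` contracts at rate `c` in forward time. -/
theorem norm_exp_neg_smul_apply_le {E : Type*} [NormedAddCommGroup E] [InnerProductSpace ℝ E]
    [CompleteSpace E] {B : E →L[ℝ] E} {c : ℝ} (hB : ∀ x, c * ‖x‖ ^ 2 ≤ inner ℝ x (B x))
    {t : ℝ} (ht : 0 ≤ t) (x : E) :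
    ‖NormedSpace.exp ((-t) • B) x‖ ≤ Real.exp (-c * t) * ‖x‖ := by
  let v : ℝ → E := fun s => NormedSpace.exp ((-s) • B) x
  have hv : ∀ s, HasDerivAt v (-B (v s)) s := fun s => by
    simpa [Function.comp_def, v] using
      (hasDerivAt_exp_smul_apply B x (-s)).scomp s (hasDerivAt_neg s)
  -- Lyapunov function: the expansion hypothesis makes this derivative nonpositive.
  have hd : ∀ s, HasDerivAt (fun s => Real.exp (2 * c * s) * ‖v s‖ ^ 2)
      (2 * Real.exp (2 * c * s) * (c * ‖v s‖ ^ 2 - inner ℝ (v s) (B (v s)))) s := fun s => by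
    refine ((((hasDerivAt_id s).const_mul (2 * c)).exp).mul (hv s).norm_sq).congr_deriv ?_
    simp only [id, inner_neg_right]
    ring
  have hanti : Antitone fun s => Real.exp (2 * c * s) * ‖v s‖ ^ 2 := by
    refine antitone_of_deriv_nonpos (fun s => (hd s).differentiableAt) fun s => ?_
    rw [(hd s).deriv]
    exact mul_nonpos_of_nonneg_of_nonpos (by positivity) (by linarith [hB (v s)])
  have h0 : Real.exp (2 * c * t) * ‖v t‖ ^ 2 ≤ ‖x‖ ^ 2 := by simpa [v] using hanti ht
  have h1 : (Real.exp (c * t) * ‖v t‖) ^ 2 ≤ ‖x‖ ^ 2 := by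
    rwa [mul_pow, ← Real.exp_nat_mul, Nat.cast_ofNat, ← mul_assoc]
  have h2 := (sq_le_sq₀ (by positivity) (norm_nonneg x)).1 h1
  rw [neg_mul, Real.exp_neg, inv_mul_eq_div, le_div_iff₀ (Real.exp_pos _), mul_comm]
  exact h2

variable {E : Type*} [NormedAddCommGroup E] [NormedSpace ℝ E]

/-- The value at time `0` of the bounded solution of `w' = B w + g`, for expanding `B`. -/
noncomputable def expandingGreen (B : E →L[ℝ] E) (g : ℝ → E) : E :=
  -∫ τ in Ioi (0 : ℝ), NormedSpace.exp ((-τ) • B) (g τ)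

variable [CompleteSpace E] {B : E →L[ℝ] E} {c : ℝ}

theorem continuous_exp_smul (B : E →L[ℝ] E) : Continuous fun t : ℝ => NormedSpace.exp (t • B) :=
  continuous_iff_continuousAt.2 fun t => (hasDerivAt_exp_smul_const B t).continuousAt

theorem exp_add_smul_apply (B : E →L[ℝ] E) (s t : ℝ) (x : E) :
    NormedSpace.exp ((s + t) • B) x = NormedSpace.exp (s • B) (NormedSpace.exp (t • B) x) := by
  simpa using eq_exp_smul_apply_of_hasDerivAt B
    (x := fun r => NormedSpace.exp ((r + t) • B) x)
    (fun r => (hasDerivAt_exp_smul_apply B x (r + t)).comp_add_const r t) s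

theorem continuous_exp_neg_smul_apply (B : E →L[ℝ] E) {g : ℝ → E} (hg : Continuous g) :
    Continuous fun t : ℝ => NormedSpace.exp ((-t) • B) (g t) :=
  ((continuous_exp_smul B).comp continuous_neg).clm_apply hg

theorem integrableOn_exp_neg_mul (hc : 0 < c) (S : ℝ) :
    IntegrableOn (fun τ => Real.exp (-c * τ) * S) (Ioi 0) :=
  (integrableOn_exp_mul_Ioi (neg_lt_zero.2 hc) 0).mul_const S

omit [CompleteSpace E] in
theorem ae_norm_exp_neg_smul_apply_le
    (hB : ∀ t, 0 ≤ t → ∀ x, ‖NormedSpace.exp ((-t) • B) x‖ ≤ Real.exp (-c * t) * ‖x‖)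
    {g : ℝ → E} {S : ℝ} (hS : ∀ τ, ‖g τ‖ ≤ S) :
    ∀ᵐ τ ∂volume.restrict (Ioi (0 : ℝ)),
      ‖NormedSpace.exp ((-τ) • B) (g τ)‖ ≤ Real.exp (-c * τ) * S := by
  filter_upwards [ae_restrict_mem measurableSet_Ioi] with τ hτ
  exact (hB τ (le_of_lt hτ) _).trans (by gcongr; exact hS τ)

theorem integrableOn_exp_neg_smul_apply (hc : 0 < c)
    (hB : ∀ t, 0 ≤ t → ∀ x, ‖NormedSpace.exp ((-t) • B) x‖ ≤ Real.exp (-c * t) * ‖x‖)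
    {g : ℝ → E} {S : ℝ} (hg : Continuous g) (hS : ∀ τ, ‖g τ‖ ≤ S) :
    IntegrableOn (fun τ => NormedSpace.exp ((-τ) • B) (g τ)) (Ioi 0) :=
  (integrableOn_exp_neg_mul hc S).mono'
    (continuous_exp_neg_smul_apply B hg).aestronglyMeasurable (ae_norm_exp_neg_smul_apply_le hB hS)

/-- Translating the forcing amounts to propagating the tail of the integral. -/
theorem expandingGreen_comp_add (hc : 0 < c)
    (hB : ∀ t, 0 ≤ t → ∀ x, ‖NormedSpace.exp ((-t) • B) x‖ ≤ Real.exp (-c * t) * ‖x‖)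
    {g : ℝ → E} {S : ℝ} (hg : Continuous g) (hS : ∀ τ, ‖g τ‖ ≤ S) (t : ℝ) :
    expandingGreen B (fun τ => g (t + τ)) = NormedSpace.exp (t • B)
      ((∫ r in (0 : ℝ)..t, NormedSpace.exp ((-r) • B) (g r)) + expandingGreen B g) := by
  let F : ℝ → E := fun r => NormedSpace.exp ((-r) • B) (g r)
  have hFc : Continuous F := continuous_exp_neg_smul_apply B hg
  have hF0 : IntegrableOn F (Ioi 0) := integrableOn_exp_neg_smul_apply hc hB hg hS
  have hFt : IntegrableOn F (Ioi t) := by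
    rcases le_total 0 t with ht | ht
    · exact hF0.mono_set (Ioi_subset_Ioi ht)
    · rw [← Ioc_union_Ioi_eq_Ioi ht]
      exact (hFc.integrableOn_Icc.mono_set Ioc_subset_Icc_self).union hF0
  have hexp : ∀ τ x, NormedSpace.exp ((-τ) • B) x = NormedSpace.exp (t • B)
      (NormedSpace.exp ((-(t + τ)) • B) x) := fun τ x => by
    rw [← exp_add_smul_apply]
    congr 3
    ring
  have hshift : ∫ τ in Ioi (0 : ℝ), F (t + τ) = ∫ r in Ioi t, F r := by
    have := (measurePreserving_add_left volume t).setIntegral_preimage_emb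
      (measurableEmbedding_addLeft t) F (Ioi t)
    simpa using this
  have h1 : expandingGreen B (fun τ => g (t + τ)) =
      -NormedSpace.exp (t • B) (∫ r in Ioi t, F r) := by
    rw [← hshift, ← ContinuousLinearMap.integral_comp_comm]
    · simp only [expandingGreen, F, ← hexp]
    · have := (measurePreserving_add_left volume t).integrableOn_comp_preimage
        (measurableEmbedding_addLeft t) (f := F) (s := Ioi t)
      simpa [Function.comp_def, IntegrableOn] using this.2 hFt
  rw [h1, ← intervalIntegral.integral_Ioi_sub_Ioi' hF0 hFt, ← map_neg]
  simp only [expandingGreen, F]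
  congr 1
  abel

/-- After `expandingGreen_comp_add`, time enters only through the exponential and the upper limit of
an integral, so the product rule and the fundamental theorem of calculus suffice. -/
theorem hasDerivAt_expandingGreen (hc : 0 < c)
    (hB : ∀ t, 0 ≤ t → ∀ x, ‖NormedSpace.exp ((-t) • B) x‖ ≤ Real.exp (-c * t) * ‖x‖)
    {g : ℝ → E} {S : ℝ} (hg : Continuous g) (hS : ∀ τ, ‖g τ‖ ≤ S) (t : ℝ) :
    HasDerivAt (fun s => expandingGreen B fun τ => g (s + τ))
      (B (expandingGreen B fun τ => g (t + τ)) + g t) t := by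
  simp only [expandingGreen_comp_add hc hB hg hS]
  have hint := (continuous_exp_neg_smul_apply B hg).integral_hasStrictDerivAt 0 t
  refine ((hasDerivAt_exp_smul_const' B t).clm_apply
    (hint.hasDerivAt.add_const (expandingGreen B g))).congr_deriv ?_
  rw [← exp_add_smul_apply]
  simp

/-- The Green operator of an expanding linear vector field. -/
theorem isGreenOperator_expandingGreen (hc : 0 < c)
    (hB : ∀ t, 0 ≤ t → ∀ x, ‖NormedSpace.exp ((-t) • B) x‖ ≤ Real.exp (-c * t) * ‖x‖) :
    IsGreenOperator B c (expandingGreen B) where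
  hasDerivAt g S hg hS t := hasDerivAt_expandingGreen hc hB hg hS t
  norm_le g S hg hS := by
    rw [expandingGreen, norm_neg]
    refine (norm_integral_le_of_norm_le (integrableOn_exp_neg_mul hc S)
      (ae_norm_exp_neg_smul_apply_le hB hS)).trans_eq ?_
    rw [integral_mul_const, integral_exp_mul_Ioi (neg_lt_zero.2 hc)]
    simp
    ring
  sub g₁ g₂ S hg₁ hg₂ hS₁ hS₂ := by
    simp only [expandingGreen, map_sub]
    rw [integral_sub (integrableOn_exp_neg_smul_apply hc hB hg₁ hS₁)
      (integrableOn_exp_neg_smul_apply hc hB hg₂ hS₂)]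
    abel
  tendsto g g' S hg hS hlim :=
    (tendsto_integral_of_dominated_convergence _
      (fun n => (continuous_exp_neg_smul_apply B (hg n)).aestronglyMeasurable)
      (integrableOn_exp_neg_mul hc S) (fun n => ae_norm_exp_neg_smul_apply_le hB (hS n))
      (Eventually.of_forall fun τ =>
        ((NormedSpace.exp ((-τ) • B)).continuous.tendsto _).comp (hlim τ))).neg

end Dichotomy

/-! ### Assembling the unstable and stable blocks. -/

section Hyperbolic

/-- Time reversal turns a Green operator of `-A` into one of `A`. -/
theorem IsGreenOperator.comp_neg {E : Type*} [NormedAddCommGroup E] [NormedSpace ℝ E]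
    {A : E →L[ℝ] E} {c : ℝ} {G : (ℝ → E) → E} (hG : IsGreenOperator (-A) c G) :
    IsGreenOperator A c fun g => -G fun τ => g (-τ) where
  hasDerivAt g S hg hS t := by
    have h := ((hG.hasDerivAt (fun τ => g (-τ)) S (hg.comp continuous_neg) (fun _ => hS _)
      (-t)).scomp t (hasDerivAt_neg t)).neg
    simp only [Function.comp_def, neg_add, neg_neg] at h
    exact h.congr_deriv (by simp [add_comm])
  norm_le g S hg hS := by
    rw [norm_neg]
    exact hG.norm_le _ S (hg.comp continuous_neg) fun _ => hS _
  sub g₁ g₂ S hg₁ hg₂ hS₁ hS₂ := by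
    rw [hG.sub (fun τ => g₁ (-τ)) (fun τ => g₂ (-τ)) S (hg₁.comp continuous_neg)
      (hg₂.comp continuous_neg) (fun _ => hS₁ _) (fun _ => hS₂ _)]
    abel
  tendsto g g' S hg hS hlim :=
    (hG.tendsto _ _ S (fun n => (hg n).comp continuous_neg) (fun _ _ => hS _ _)
      fun _ => hlim _).neg

/-- Green operators of the diagonal blocks combine to one of a block diagonal map. -/
theorem IsGreenOperator.prod {E F : Type*} [NormedAddCommGroup E] [NormedSpace ℝ E]
    [NormedAddCommGroup F] [NormedSpace ℝ F] {A : E × F →L[ℝ] E × F} {A₁ : E →L[ℝ] E}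
    {A₂ : F →L[ℝ] F} {c : ℝ} {G₁ : (ℝ → E) → E} {G₂ : (ℝ → F) → F}
    (hA : ∀ x y, A (x, y) = (A₁ x, A₂ y)) (hG₁ : IsGreenOperator A₁ c G₁)
    (hG₂ : IsGreenOperator A₂ c G₂) :
    IsGreenOperator A c fun g => (G₁ fun τ => (g τ).1, G₂ fun τ => (g τ).2) where
  hasDerivAt g S hg hS t := by
    refine ((hG₁.hasDerivAt (fun τ => (g τ).1) S hg.fst
      (fun τ => (norm_fst_le _).trans (hS τ)) t).prodMk
      (hG₂.hasDerivAt (fun τ => (g τ).2) S hg.snd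
      (fun τ => (norm_snd_le _).trans (hS τ)) t)).congr_deriv ?_
    rw [hA]
    rfl
  -- With the max norm on the product, the constant c is not degraded.
  norm_le g S hg hS := norm_prod_le_iff.2
    ⟨hG₁.norm_le _ S hg.fst fun τ => (norm_fst_le _).trans (hS τ),
      hG₂.norm_le _ S hg.snd fun τ => (norm_snd_le _).trans (hS τ)⟩
  sub g₁ g₂ S hg₁ hg₂ hS₁ hS₂ := Prod.ext
    (hG₁.sub _ _ S hg₁.fst hg₂.fst (fun τ => (norm_fst_le _).trans (hS₁ τ))
      fun τ => (norm_fst_le _).trans (hS₂ τ))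
    (hG₂.sub _ _ S hg₁.snd hg₂.snd (fun τ => (norm_snd_le _).trans (hS₁ τ))
      fun τ => (norm_snd_le _).trans (hS₂ τ))
  tendsto g g' S hg hS hlim :=
    (hG₁.tendsto _ _ S (fun n => (hg n).fst) (fun n τ => (norm_fst_le _).trans (hS n τ))
      fun τ => (hlim τ).fst_nhds).prodMk_nhds
    (hG₂.tendsto _ _ S (fun n => (hg n).snd) (fun n τ => (norm_snd_le _).trans (hS n τ))
      fun τ => (hlim τ).snd_nhds)

theorem isGreenOperator_expandingGreen_of_inner {E : Type*} [NormedAddCommGroup E]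
    [InnerProductSpace ℝ E] [CompleteSpace E] {B : E →L[ℝ] E} {c : ℝ} (hc : 0 < c)
    (hB : ∀ x, c * ‖x‖ ^ 2 ≤ inner ℝ x (B x)) : IsGreenOperator B c (expandingGreen B) :=
  isGreenOperator_expandingGreen hc fun _ ht => norm_exp_neg_smul_apply_le hB ht

end Hyperbolic

end HartmanGrobman

/-! ### The theorem for the hyperbolic splitting. -/

theorem mainTheorem3 (u s : ℕ)
    (A_u : EuclideanSpace ℝ (Fin u) →L[ℝ] EuclideanSpace ℝ (Fin u))
    (A_s : EuclideanSpace ℝ (Fin s) →L[ℝ] EuclideanSpace ℝ (Fin s))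
    (A : PhaseSpace u s →L[ℝ] PhaseSpace u s)
    (hA : ∀ (x : EuclideanSpace ℝ (Fin u)) (y : EuclideanSpace ℝ (Fin s)),
      A (x, y) = (A_u x, A_s y))
    (hAu : ∃ c_u : ℝ, 0 < c_u ∧
      ∀ x : EuclideanSpace ℝ (Fin u), c_u * ‖x‖ ^ 2 ≤ inner ℝ x (A_u x))
    (hAs : ∃ c_s : ℝ, 0 < c_s ∧
      ∀ y : EuclideanSpace ℝ (Fin s), inner ℝ y (A_s y) ≤ -c_s * ‖y‖ ^ 2) :
    ∃ ε₀ : ℝ, 0 < ε₀ ∧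
      ∀ (h : PhaseSpace u s → PhaseSpace u s) (M ε : ℝ),
        ContDiff ℝ 1 h → (∀ z, ‖h z‖ ≤ M) → (∀ z, ‖fderiv ℝ h z‖ ≤ ε) → ε < ε₀ →
          ∃ φ : Flow ℝ (PhaseSpace u s),
            IsFlowOfODE (fun z => A z + h z) φ ∧
            ∃ ρ : PhaseSpace u s ≃ₜ PhaseSpace u s,
              ∀ (t : ℝ) (z : PhaseSpace u s),
                ρ (NormedSpace.exp (t • A) z) = φ t (ρ z) := by
  obtain ⟨c_u, hcu, hu⟩ := hAu
  obtain ⟨c_s, hcs, hs⟩ := hAs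
  have hc : 0 < min c_u c_s := lt_min hcu hcs
  have hGu : IsGreenOperator A_u (min c_u c_s) (expandingGreen A_u) :=
    isGreenOperator_expandingGreen_of_inner hc fun x =>
      (mul_le_mul_of_nonneg_right (min_le_left _ _) (sq_nonneg _)).trans (hu x)
  -- The stable block expands under time reversal; `IsGreenOperator.comp_neg` later undoes the
  -- reversal.
  have hGs : IsGreenOperator (-A_s) (min c_u c_s) (expandingGreen (-A_s)) :=
    isGreenOperator_expandingGreen_of_inner hc fun y => by
      have h1 := mul_le_mul_of_nonneg_right (min_le_right c_u c_s) (sq_nonneg ‖y‖)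
      have h2 : inner ℝ y ((-A_s) y) = -inner ℝ y (A_s y) := inner_neg_right _ _
      rw [h2]
      linarith [hs y]
  -- The threshold is the reciprocal of the Green bound: ε below it is what makes ε / c a
  -- contraction factor.
  refine ⟨min c_u c_s, hc, fun h M ε hh hM hε hlt => ?_⟩
  have hε0 : 0 ≤ ε := (norm_nonneg _).trans (hε 0)
  have hK : LipschitzWith ⟨ε, hε0⟩ h :=
    lipschitzWith_of_nnnorm_fderiv_le (hh.differentiable one_ne_zero) hε
  obtain ⟨φ, hφ⟩ := exists_isFlowOfODE_of_lipschitzWith (A.lipschitz.add hK)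
    (A.contDiff.add hh)
  exact ⟨φ, hφ, (hGu.prod hA hGs.comp_neg).exists_homeomorph_conj hc hM hK hlt hφ⟩
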